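/- Let $G=(V,E)$ be a finite simple graph. For a real symmetric matrix $M$ let $\lambda_i(M)$ denote its $i$-th smallest eigenvalue, counted with multiplicity. The algebraic connectivity of a graph $H$ is $a(H)=\lambda_2(L(H))$, where $L(H)$ is the Laplacian matrix of $H$, with the convention $a(H)=\infty$ if $H$ has a single vertex. Let $d\ge 1$. For $p:V\to\mathbb R^d$ and $u,v\in V$ let $d_{uv}=\frac{p(u)-p(v)}{\|p(u)-p(v)\|}$ if $p(u)\ne p(v)$, and $d_{uv}=0$ otherwise. Let $R(G,p)\in\mathbb R^{d|V|\times|E|}$ be the matrix whose columns are the vectors $(1_u-1_v)\otimes d_{uv}$ for $\{u,v\}\in E$, where $\{1_u\}_{u\in V}$ is the standard basis of $\mathbb R^{V}$, and let $L(G,p)=R(G,p)R(G,p)^T$. The $d$-dimensional algebraic connectivity of $G$ is $$a_d(G)=\sup\left\{\lambda_{\binom{d+1}{2}+1}(L(G,p)) : p:V\to\mathbb R^d\right\}.$$ A graph $G$ with $|V|\ge d$ is called $d$-rigid if there is a map $p:V\to\mathbb R^d$ with $\operatorname{rank} R(G,p)=d|V|-\binom{d+1}{2}$. For disjoint $A,B\subseteq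 V$ let $G[A]$ be the subgraph of $G$ induced on $A$, and let $G(A,B)$ be the graph with vertex set $A\cup B$ whose edges are the edges of $G$ with one endpoint in $A$ and the other in $B$. **Theorem.** Let $d\ge 2$, let $G=(V,E)$ be a finite simple graph, and let $V=A_1\cup\cdots\cup A_d$ be a partition of $V$ into $d$ nonempty parts. Then: 1. $$a_d(G)\ \ge\ \min\left(\{a(G[A_i])\}_{1\le i\le d}\cup\left\{\tfrac12\,a(G(A_i,A_j))\right\}_{1\le i<j\le d}\right).$$ 2. If $G[A_i]$ is connected for all $1\le i\le d$ and $G(A_i,A_j)$ is connected for all $1\le i<j\le d$, then $G$ is $d$-rigid. 3. If $d=2$, then moreover $a_2(G)\ge\min\{a(G[A_1]),\,a(G[A_2]),\,a(G(A_1,A_2))\}$. -/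

import Mathlib

namespace Rigidity

/-- `lam A hA i` is the `i`-th smallest eigenvalue (`i = 1, 2, …`, counted with multiplicity) of the
real symmetric matrix `A`, with value `∞` if `A` has fewer than `i` rows.
Mathlib's `eigenvalues₀` lists the eigenvalues in decreasing order. -/
noncomputable def lam {ι : Type*} [Finite ι] (A : Matrix ι ι ℝ) (hA : A.IsHermitian) (i : ℕ) :
    EReal :=
  letI := Fintype.ofFinite ι
  letI := Classical.decEq ι
  if h : 1 ≤ i ∧ i ≤ Fintype.card ι then
    ((hA.eigenvalues₀ ⟨Fintype.card ι - i, by omega⟩ : ℝ) : EReal)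
  else ⊤

/-- The graph Laplacian. -/
noncomputable def laplacian {V : Type*} [Finite V] (G : SimpleGraph V) : Matrix V V ℝ :=
  letI := Fintype.ofFinite V
  letI := Classical.decEq V
  letI := Classical.decRel G.Adj
  G.lapMatrix ℝ

theorem laplacian_isHermitian {V : Type*} [Finite V] (G : SimpleGraph V) :
    (laplacian G).IsHermitian := by
  letI := Fintype.ofFinite V
  letI := Classical.decEq V
  letI := Classical.decRel G.Adj
  exact G.isHermitian_lapMatrix ℝ

/-- The algebraic connectivity `a(G)`: the second smallest eigenvalue of the Laplacian, which is
`∞` for a graph with a single vertex. -/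
noncomputable def algConn {V : Type*} [Finite V] (G : SimpleGraph V) : EReal :=
  lam (laplacian G) (laplacian_isHermitian G) 2

/-- The unit vector `(p u - p v) / ‖p u - p v‖`, and `0` if `p u = p v`. -/
noncomputable def unitDir {V : Type*} {d : ℕ} (p : V → EuclideanSpace ℝ (Fin d)) (u v : V) :
    EuclideanSpace ℝ (Fin d) :=
  ‖p u - p v‖⁻¹ • (p u - p v)

theorem unitDir_swap {V : Type*} {d : ℕ} (p : V → EuclideanSpace ℝ (Fin d)) (u v : V) :
    unitDir p v u = -unitDir p u v := by
  unfold unitDir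
  rw [norm_sub_rev, ← smul_neg, neg_sub]

/-- The vector `(1_u - 1_v) ⊗ d_{uv}` of length `d|V|`, where `d_{uv} = unitDir p u v`. -/
noncomputable def edgeVec {V : Type*} {d : ℕ} (p : V → EuclideanSpace ℝ (Fin d)) (u v : V) :
    V × Fin d → ℝ :=
  letI := Classical.decEq V
  fun x => ((Pi.single u 1 : V → ℝ) x.1 - (Pi.single v 1 : V → ℝ) x.1) * unitDir p u v x.2

theorem edgeVec_swap {V : Type*} {d : ℕ} (p : V → EuclideanSpace ℝ (Fin d)) (u v : V) :
    edgeVec p u v = edgeVec p v u := by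
  funext x
  simp only [edgeVec, unitDir_swap p u v, PiLp.neg_apply]
  ring

/-- The normalized rigidity matrix `R(G,p)`: the column of the edge `{u, v}` is
`(1_u - 1_v) ⊗ d_{uv}`, which does not depend on the order of `u` and `v`. -/
noncomputable def rigidityMatrix {V : Type*} {d : ℕ} (G : SimpleGraph V)
    (p : V → EuclideanSpace ℝ (Fin d)) : Matrix (V × Fin d) G.edgeSet ℝ :=
  Matrix.of fun x e => Sym2.lift ⟨edgeVec p, edgeVec_swap p⟩ (e : Sym2 V) x

/-- The stiffness matrix `L(G,p) = R(G,p) R(G,p)ᵀ`. -/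
noncomputable def stiffnessMatrix {V : Type*} [Finite V] {d : ℕ} (G : SimpleGraph V)
    (p : V → EuclideanSpace ℝ (Fin d)) : Matrix (V × Fin d) (V × Fin d) ℝ :=
  letI := Fintype.ofFinite G.edgeSet
  rigidityMatrix G p * (rigidityMatrix G p).transpose

theorem stiffnessMatrix_isHermitian {V : Type*} [Finite V] {d : ℕ} (G : SimpleGraph V)
    (p : V → EuclideanSpace ℝ (Fin d)) : (stiffnessMatrix G p).IsHermitian := by
  letI := Fintype.ofFinite G.edgeSet
  exact Matrix.isHermitian_mul_conjTranspose_self (rigidityMatrix G p)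

/-- The `d`-dimensional algebraic connectivity `a_d(G)`: the supremum over all maps `p : V → ℝᵈ`
of the `(binom(d+1, 2) + 1)`-th smallest eigenvalue of `L(G,p)`. -/
noncomputable def algConnDim {V : Type*} [Finite V] (d : ℕ) (G : SimpleGraph V) : EReal :=
  ⨆ p : V → EuclideanSpace ℝ (Fin d),
    lam (stiffnessMatrix G p) (stiffnessMatrix_isHermitian G p) ((d + 1).choose 2 + 1)

/-- `(G,p)` is infinitesimally rigid: `rank R(G,p) = d|V| - binom(d+1, 2)`, for graphs with at
least `d` vertices. If `|V| ≥ d + 1`, the equality forces `p(V)` to lie on no affine hyperplane. -/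
def InfinitesimallyRigid {V : Type*} [Finite V] {d : ℕ} (G : SimpleGraph V)
    (p : V → EuclideanSpace ℝ (Fin d)) : Prop :=
  letI := Fintype.ofFinite G.edgeSet
  (rigidityMatrix G p).rank + (d + 1).choose 2 = d * Nat.card V

/-- `G` is `d`-rigid: infinitesimally rigid with respect to some map `p : V → ℝᵈ`. -/
def IsRigid {V : Type*} [Finite V] (d : ℕ) (G : SimpleGraph V) : Prop :=
  ∃ p : V → EuclideanSpace ℝ (Fin d), InfinitesimallyRigid G p

/-- The graph `G(A,B)` with vertex set `A ∪ B`, whose edges are the edges of `G` with one endpoint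
in `A` and the other in `B` (for disjoint `A` and `B`). -/
def bipartiteBetween {V : Type*} (G : SimpleGraph V) (A B : Set V) :
    SimpleGraph (A ∪ B : Set V) :=
  (G.between A B).induce (A ∪ B)

end Rigidity

namespace Rigidity

open Matrix Finset

/-! Put every vertex of the class `A i` near the vertex `e_i` of the standard simplex, shifted along
the all-ones vector by a small amount distinct for each vertex of the class. Edges inside a class
then point exactly along the all-ones vector, and edges between `A i` and `A j` point almost along
`e_i - e_j`. In the limit the stiffness form decouples: on a vector field `f` it is `1/d` times the
Laplacian forms of the `G[A i]` at `∑ k, f (u, k)`, plus `1/2` times the Laplacian forms of the `G(A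
i, A j)` at `f (u, i) - f (u, j)`.

These forms have spectral gaps once the arguments have sum zero: one linear condition for each class
and one for each pair of classes, `binom(d+1, 2)` in all. On the common kernel of these conditions
the gaps bound the form from below (`limit_form_ge`). At a vertex of class `i` the pairs only see
the differences `x i - x j` of the sum-zero part `x` of `f (u, ·)`; comparing `∑ j, (x i - x j) ^ 2`
with `∑ k, x k ^ 2` costs the factor `1/2` in general and nothing for `d = 2`.

The limit is approached uniformly in `f` (`exists_placement`), so Courant–Fischer
(`le_lam_of_rayleigh`) bounds the required eigenvalue. For rigidity, connectedness makes all gaps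
positive, which leaves a kernel of dimension at most `binom(d+1, 2)`; the infinitesimal isometries
show that it is no smaller. -/

/-! ### Eigenvalues and Rayleigh quotients. -/

theorem dotProduct_mulVec_eq_sum_eigenvalues {ι : Type*} [Fintype ι] [DecidableEq ι]
    {A : Matrix ι ι ℝ} (hA : A.IsHermitian) (x : ι → ℝ) :
    x ⬝ᵥ (A *ᵥ x) =
      ∑ i, hA.eigenvalues i * (x ⬝ᵥ (hA.eigenvectorBasis i : ι → ℝ)) ^ 2 := by
  have h := hA.eigenvectorBasis.sum_inner_mul_inner (WithLp.toLp 2 x) (WithLp.toLp 2 (A *ᵥ x))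
  have h1 : ∀ y : ι → ℝ, ∀ i, inner ℝ (WithLp.toLp 2 y) (hA.eigenvectorBasis i) =
      y ⬝ᵥ (hA.eigenvectorBasis i : ι → ℝ) := by
    intro y i
    simp [PiLp.inner_apply, dotProduct, mul_comm]
  have h2 : inner ℝ (WithLp.toLp 2 x) (WithLp.toLp 2 (A *ᵥ x)) = x ⬝ᵥ (A *ᵥ x) := by
    simp [PiLp.inner_apply, dotProduct, mul_comm]
  rw [← h2, ← h]
  refine Finset.sum_congr rfl fun i _ => ?_
  rw [real_inner_comm (WithLp.toLp 2 (A *ᵥ x)), h1, h1]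
  have hs : Aᵀ = A := isHermitian_iff_isSymm.1 hA
  have : (A *ᵥ x) ⬝ᵥ (hA.eigenvectorBasis i : ι → ℝ) =
      hA.eigenvalues i * (x ⬝ᵥ (hA.eigenvectorBasis i : ι → ℝ)) := by
    rw [dotProduct_comm, dotProduct_mulVec, ← mulVec_transpose, hs, hA.mulVec_eigenvectorBasis,
      smul_dotProduct, smul_eq_mul, dotProduct_comm x]
  rw [this]
  ring

theorem dotProduct_self_eq_sum_eigenvectorBasis {ι : Type*} [Fintype ι] [DecidableEq ι]
    {A : Matrix ι ι ℝ} (hA : A.IsHermitian) (x : ι → ℝ) :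
    x ⬝ᵥ x = ∑ i, (x ⬝ᵥ (hA.eigenvectorBasis i : ι → ℝ)) ^ 2 := by
  have h := hA.eigenvectorBasis.sum_inner_mul_inner (WithLp.toLp 2 x) (WithLp.toLp 2 x)
  have h1 : ∀ i, inner ℝ (WithLp.toLp 2 x) (hA.eigenvectorBasis i) =
      x ⬝ᵥ (hA.eigenvectorBasis i : ι → ℝ) := by
    intro i
    simp [PiLp.inner_apply, dotProduct, mul_comm]
  have h2 : inner ℝ (WithLp.toLp 2 x) (WithLp.toLp 2 x) = x ⬝ᵥ x := by
    rw [PiLp.inner_apply]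
    rfl
  rw [← h2, ← h]
  refine Finset.sum_congr rfl fun i _ => ?_
  rw [real_inner_comm (WithLp.toLp 2 x), h1, sq]

theorem lam_eq {ι : Type*} [Finite ι] [hι : Fintype ι] [hd : DecidableEq ι] {A : Matrix ι ι ℝ}
    (hA : A.IsHermitian) (i : ℕ) :
    lam A hA i = if h : 1 ≤ i ∧ i ≤ Fintype.card ι then
      ((hA.eigenvalues₀ ⟨Fintype.card ι - i, by omega⟩ : ℝ) : EReal) else ⊤ := by
  obtain rfl : hι = Fintype.ofFinite ι := Subsingleton.elim _ _
  obtain rfl : hd = Classical.decEq ι := Subsingleton.elim _ _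
  rfl

/-- One half of the Courant–Fischer theorem: a lower bound for the Rayleigh quotient on a subspace
of codimension at most `k` is a lower bound for the `(k + 1)`-st smallest eigenvalue. -/
theorem le_lam_of_rayleigh {ι κ : Type*} [Fintype ι] [Fintype κ] {A : Matrix ι ι ℝ}
    (hA : A.IsHermitian) {m : ℝ} (T : (ι → ℝ) →ₗ[ℝ] (κ → ℝ))
    (h : ∀ x, T x = 0 → m * (x ⬝ᵥ x) ≤ x ⬝ᵥ (A *ᵥ x)) :
    (m : EReal) ≤ lam A hA (Fintype.card κ + 1) := by
  classical
  rw [lam_eq]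
  split_ifs with hk
  swap
  · exact le_top
  rw [EReal.coe_le_coe_iff]
  set r : Fin (Fintype.card ι) := ⟨Fintype.card ι - (Fintype.card κ + 1), by omega⟩ with hr
  -- This is the reindexing inside the definition of `eigenvalues`, which is why `hev` holds by
  -- `rfl`.
  set e : Fin (Fintype.card ι) ≃ ι := Fintype.equivOfCardEq (Fintype.card_fin _) with he
  have hev : ∀ i, hA.eigenvalues i = hA.eigenvalues₀ (e.symm i) := fun i => rfl
  let B : (ι → ℝ) →ₗ[ℝ] ({i : Fin (Fintype.card ι) // i < r} → ℝ) :=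
    LinearMap.pi fun i => dotProductBilin ℝ ℝ (hA.eigenvectorBasis (e i) : ι → ℝ)
  -- `T` imposes `card κ` conditions, and orthogonality to the eigenvectors before index `r` (the
  -- order is decreasing) imposes `card ι - card κ - 1`. One dimension is left.
  have hlt : Module.finrank ℝ ((κ → ℝ) × ({i : Fin (Fintype.card ι) // i < r} → ℝ)) <
      Module.finrank ℝ (ι → ℝ) := by
    rw [Module.finrank_prod, Module.finrank_fintype_fun_eq_card, Module.finrank_fintype_fun_eq_card,
      Module.finrank_fintype_fun_eq_card, Fintype.card_subtype]
    have : (Finset.univ.filter fun i => i < r) = Finset.Iio r := by ext; simp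
    rw [this, Fin.card_Iio]
    simp only [hr]
    omega
  obtain ⟨x, hx, hx0⟩ := Submodule.exists_mem_ne_zero_of_ne_bot
    (LinearMap.ker_ne_bot_of_finrank_lt (f := T.prod B) hlt)
  have hTx : T x = 0 := congrArg Prod.fst hx
  have hBx : ∀ i, e.symm i < r → x ⬝ᵥ (hA.eigenvectorBasis i : ι → ℝ) = 0 := by
    intro i hi
    have := congrFun (congrArg Prod.snd hx) ⟨e.symm i, hi⟩
    simpa [B, dotProduct_comm] using this
  have hpos : 0 < x ⬝ᵥ x := by
    have h1 : 0 ≤ x ⬝ᵥ x := Finset.sum_nonneg fun i _ => mul_self_nonneg _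
    exact lt_of_le_of_ne h1 fun h2 => hx0 (dotProduct_self_eq_zero.1 h2.symm)
  have h3 : x ⬝ᵥ (A *ᵥ x) ≤ hA.eigenvalues₀ r * (x ⬝ᵥ x) := by
    rw [dotProduct_mulVec_eq_sum_eigenvalues hA, dotProduct_self_eq_sum_eigenvectorBasis hA,
      Finset.mul_sum]
    refine Finset.sum_le_sum fun i _ => ?_
    by_cases hi : e.symm i < r
    · simp [hBx i hi]
    · rw [hev]
      exact mul_le_mul_of_nonneg_right (hA.eigenvalues₀_antitone (not_lt.1 hi)) (sq_nonneg _)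
  exact le_of_mul_le_mul_right ((h x hTx).trans h3) hpos

/-- If a positive semidefinite matrix annihilates a vector, then its second smallest eigenvalue
bounds its Rayleigh quotient from below on the orthogonal complement of this vector. -/
theorem rayleigh_of_le_lam_two {ι : Type*} [Fintype ι] {A : Matrix ι ι ℝ} (hA : A.IsHermitian)
    (hpsd : ∀ x, 0 ≤ x ⬝ᵥ (A *ᵥ x)) {z : ι → ℝ} (hz : z ≠ 0) (hAz : A *ᵥ z = 0) {m : ℝ}
    (hm : (m : EReal) ≤ lam A hA 2) {x : ι → ℝ} (hx : x ⬝ᵥ z = 0) :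
    m * (x ⬝ᵥ x) ≤ x ⬝ᵥ (A *ᵥ x) := by
  classical
  have hself : ∀ y : ι → ℝ, 0 ≤ y ⬝ᵥ y := fun y => Finset.sum_nonneg fun i _ => mul_self_nonneg _
  have hpos : 0 < z ⬝ᵥ z :=
    lt_of_le_of_ne (hself z) fun h2 => hz (dotProduct_self_eq_zero.1 h2.symm)
  rcases le_or_gt m 0 with hm0 | hm0
  · exact (mul_nonpos_of_nonpos_of_nonneg hm0 (hself x)).trans (hpsd x)
  rw [lam_eq] at hm
  split_ifs at hm with hk
  swap
  -- Here `lam` takes its default value `⊤`, and `x ⬝ᵥ z = 0` forces `x = 0`.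
  · have : Subsingleton ι := by
      rw [← Fintype.card_le_one_iff_subsingleton]; omega
    obtain ⟨i, hi⟩ := Function.ne_iff.1 hz
    have hsum : ∀ a b : ι → ℝ, a ⬝ᵥ b = a i * b i := fun a b =>
      Fintype.sum_subsingleton _ i
    have hxi : x i = 0 := by
      rw [hsum] at hx
      exact (mul_eq_zero.1 hx).resolve_right hi
    rw [hsum, hsum, hxi]
    simp
  rw [EReal.coe_le_coe_iff] at hm
  set r : Fin (Fintype.card ι) := ⟨Fintype.card ι - 2, by omega⟩ with hr
  set e : Fin (Fintype.card ι) ≃ ι := Fintype.equivOfCardEq (Fintype.card_fin _) with he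
  have hev : ∀ i, hA.eigenvalues i = hA.eigenvalues₀ (e.symm i) := fun i => rfl
  set l : ι := e ⟨Fintype.card ι - 1, by omega⟩ with hl
  set w : ι → ℝ := (hA.eigenvectorBasis l : ι → ℝ) with hw
  -- The bound is clear orthogonally to the bottom eigenvector `w`. As `z` itself need not be this
  -- basis vector, the bound is then carried over to the complement of `z`.
  have key : ∀ y : ι → ℝ, y ⬝ᵥ w = 0 → m * (y ⬝ᵥ y) ≤ y ⬝ᵥ (A *ᵥ y) := by
    intro y hy
    rw [dotProduct_mulVec_eq_sum_eigenvalues hA, dotProduct_self_eq_sum_eigenvectorBasis hA,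
      Finset.mul_sum]
    refine Finset.sum_le_sum fun i _ => ?_
    by_cases hi : i = l
    · rw [hi, ← hw, hy]; simp
    · rw [hev]
      refine mul_le_mul_of_nonneg_right (hm.trans (hA.eigenvalues₀_antitone ?_)) (sq_nonneg _)
      have h1 : e.symm i ≠ ⟨Fintype.card ι - 1, by omega⟩ := fun h => hi (by rw [hl, ← h]; simp)
      have h2 := (e.symm i).2
      rw [Fin.le_def, hr]
      have h3 : (e.symm i : ℕ) ≠ Fintype.card ι - 1 := fun h => h1 (Fin.ext h)
      simp only
      omega
  have hzw : z ⬝ᵥ w ≠ 0 := by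
    intro h
    have := key z h
    rw [hAz, dotProduct_zero] at this
    nlinarith
  have hzA : ∀ y, z ⬝ᵥ (A *ᵥ y) = 0 := by
    intro y
    have hs : Aᵀ = A := isHermitian_iff_isSymm.1 hA
    rw [dotProduct_mulVec, ← mulVec_transpose, hs, hAz, zero_dotProduct]
  -- This combination is orthogonal to `w`. Since `A` kills `z`, its form is `(z ⬝ᵥ w) ^ 2` times
  -- that of `x`, while the `z` component only increases the norm.
  have h1 := key ((x ⬝ᵥ w) • z - (z ⬝ᵥ w) • x) (by
    simp only [sub_dotProduct, smul_dotProduct, smul_eq_mul]; ring)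
  simp only [mulVec_sub, mulVec_smul, hAz, sub_dotProduct, dotProduct_sub, smul_dotProduct,
    dotProduct_smul, smul_eq_mul, hzA, dotProduct_zero, hx, dotProduct_comm z x] at h1
  have h2 : 0 < (z ⬝ᵥ w) ^ 2 := by positivity
  have h3 : 0 ≤ m * ((x ⬝ᵥ w) ^ 2 * (z ⬝ᵥ z)) := by positivity
  refine le_of_mul_le_mul_left ?_ h2
  nlinarith

/-! ### Laplacian forms and spectral gaps. -/

theorem sum_edgeSet_eq_half_sum_adj {V : Type*} [Fintype V] (G : SimpleGraph V)
    [DecidableRel G.Adj] [Fintype G.edgeSet] (F : Sym2 V → ℝ) :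
    ∑ e : G.edgeSet, F e = (∑ u, ∑ v, if G.Adj u v then F s(u, v) else 0) / 2 := by
  classical
  have h1 : ∑ D : G.Dart, F D.edge = 2 * ∑ e : G.edgeSet, F e := by
    rw [← Finset.sum_fiberwise_of_maps_to (s := univ) (t := univ)
      (g := fun D : G.Dart => (⟨D.edge, D.edge_mem⟩ : G.edgeSet)) (fun _ _ => mem_univ _),
      Finset.mul_sum]
    refine Finset.sum_congr rfl fun e _ => ?_
    rw [Finset.sum_congr rfl (g := fun _ => F e)]
    · rw [Finset.sum_const, nsmul_eq_mul]
      have := G.dart_edge_fiber_card e.1 e.2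
      simp only [Subtype.ext_iff]
      rw [this]
      norm_num
    · intro D hD
      rw [← (mem_filter.1 hD).2]
  have h2 : ∑ D : G.Dart, F D.edge = ∑ u, ∑ v, if G.Adj u v then F s(u, v) else 0 := by
    rw [← Finset.sum_product', ← Finset.sum_filter]
    refine Finset.sum_bij (fun D _ => D.toProd) ?_ ?_ ?_ ?_
    · intro D _
      simp
    · intro a _ b _ h
      exact SimpleGraph.Dart.ext _ _ h
    · rintro ⟨u, v⟩ h
      exact ⟨⟨(u, v), by simpa using h⟩, mem_univ _, rfl⟩
    · intro D _
      rfl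
  rw [← h2, h1]
  ring

/-- The Laplacian form of `G` is at least `m` times the squared norm on vectors with sum zero. -/
def HasGap {V : Type*} [Fintype V] (G : SimpleGraph V) (m : ℝ) : Prop :=
  ∀ y : V → ℝ, ∑ u, y u = 0 → m * (y ⬝ᵥ y) ≤ y ⬝ᵥ (laplacian G *ᵥ y)

theorem dotProduct_laplacian_mulVec {V : Type*} [Fintype V] (G : SimpleGraph V)
    [DecidableRel G.Adj] (y : V → ℝ) :
    y ⬝ᵥ (laplacian G *ᵥ y) = (∑ u, ∑ v, if G.Adj u v then (y u - y v) ^ 2 else 0) / 2 := by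
  classical
  have : laplacian G = G.lapMatrix ℝ := by
    unfold laplacian
    congr!
  rw [this, ← G.lapMatrix_toLinearMap₂' ℝ y, toLinearMap₂'_apply']

theorem laplacian_form_nonneg {V : Type*} [Fintype V] (G : SimpleGraph V) (y : V → ℝ) :
    0 ≤ y ⬝ᵥ (laplacian G *ᵥ y) := by
  classical
  rw [dotProduct_laplacian_mulVec]
  refine div_nonneg (sum_nonneg fun u _ => sum_nonneg fun v _ => ?_) two_pos.le
  split_ifs <;> positivity

theorem hasGap_of_le_algConn {V : Type*} [Fintype V] [Nonempty V] {G : SimpleGraph V} {m : ℝ}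
    (h : (m : EReal) ≤ algConn G) : HasGap G m := by
  classical
  intro y hy
  refine rayleigh_of_le_lam_two (laplacian_isHermitian G) (laplacian_form_nonneg G)
    (z := fun _ => 1) ?_ ?_ h ?_
  · obtain ⟨v⟩ := ‹Nonempty V›
    exact fun h => one_ne_zero (congrFun h v)
  · have : laplacian G = G.lapMatrix ℝ := by
      unfold laplacian
      congr!
    rw [this]
    exact G.lapMatrix_mulVec_const_eq_zero
  · simpa [dotProduct] using hy

theorem hasGap_zero {V : Type*} [Fintype V] (G : SimpleGraph V) : HasGap G 0 := by
  intro y _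
  rw [zero_mul]
  exact laplacian_form_nonneg G y

theorem HasGap.mono {V : Type*} [Fintype V] {G : SimpleGraph V} {m m' : ℝ} (h : HasGap G m)
    (hm : m' ≤ m) : HasGap G m' := fun y hy =>
  (mul_le_mul_of_nonneg_right hm (sum_nonneg fun _ _ => mul_self_nonneg _)).trans (h y hy)

theorem HasGap.max_zero {V : Type*} [Fintype V] {G : SimpleGraph V} {m : ℝ} (h : HasGap G m) :
    HasGap G (max m 0) := by
  rcases max_choice m 0 with h' | h' <;> rw [h']
  exacts [h, hasGap_zero G]

/-- The gap is the minimum of the form on the compact unit sphere of the sum-zero vectors. It is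
positive because, on a connected graph, the form vanishes only on constants. The sphere is empty for
a single vertex, where any gap will do. -/
theorem exists_hasGap_of_connected {V : Type*} [Fintype V] {G : SimpleGraph V}
    (hG : G.Connected) : ∃ m : ℝ, 0 < m ∧ HasGap G m := by
  classical
  let K : Set (V → ℝ) := {y | ∑ u, y u = 0 ∧ y ⬝ᵥ y = 1}
  have hcont : Continuous fun y : V → ℝ => y ⬝ᵥ (laplacian G *ᵥ y) := by
    simp only [dotProduct_laplacian_mulVec]
    refine Continuous.div_const (continuous_finsetSum _ fun u _ =>
      continuous_finsetSum _ fun v _ => ?_) _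
    split_ifs <;> fun_prop
  have hK : IsCompact K := by
    refine (isCompact_univ_pi fun _ : V => isCompact_Icc (a := (-1 : ℝ)) (b := 1)).of_isClosed_subset
      ?_ ?_
    · refine (isClosed_eq (by fun_prop) continuous_const).inter
        (isClosed_eq ?_ continuous_const)
      unfold dotProduct
      fun_prop
    · intro y hy i _
      have : y i * y i ≤ y ⬝ᵥ y :=
        single_le_sum (f := fun i => y i * y i) (fun i _ => mul_self_nonneg _) (mem_univ i)
      rw [hy.2] at this
      exact abs_le.1 (abs_le_one_iff_mul_self_le_one.2 this)
  have hscale : ∀ y : V → ℝ, ∑ u, y u = 0 → y ≠ 0 → (Real.sqrt (y ⬝ᵥ y))⁻¹ • y ∈ K := by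
    intro y hy hy0
    have h1 : 0 ≤ y ⬝ᵥ y := sum_nonneg fun i _ => mul_self_nonneg _
    have h2 : y ⬝ᵥ y ≠ 0 := fun h => hy0 (dotProduct_self_eq_zero.1 h)
    refine ⟨by simp [← mul_sum, hy], ?_⟩
    rw [smul_dotProduct, dotProduct_smul, smul_eq_mul, smul_eq_mul, ← mul_assoc, ← mul_inv,
      Real.mul_self_sqrt h1, inv_mul_cancel₀ h2]
  rcases K.eq_empty_or_nonempty with hE | hE
  · refine ⟨1, one_pos, fun y hy => ?_⟩
    have : y = 0 := by
      by_contra h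
      have := hscale y hy h
      rw [hE] at this
      exact this
    simp [this]
  · obtain ⟨z, hz, hmin⟩ := hK.exists_isMinOn hE hcont.continuousOn
    refine ⟨z ⬝ᵥ (laplacian G *ᵥ z), ?_, ?_⟩
    · refine lt_of_le_of_ne (laplacian_form_nonneg G z) fun h => ?_
      have h0 : ∀ i j, z i = z j := by
        rw [dotProduct_laplacian_mulVec, ← G.lapMatrix_toLinearMap₂' ℝ z, eq_comm,
          G.lapMatrix_toLinearMap₂'_apply'_eq_zero_iff_forall_reachable] at h
        exact fun i j => h i j (hG.preconnected i j)
      obtain ⟨v⟩ := hG.nonempty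
      have h1 : z v = 0 := by
        have := hz.1
        rw [sum_congr rfl fun i _ => h0 i v, sum_const, nsmul_eq_mul] at this
        exact (mul_eq_zero.1 this).resolve_left (Nat.cast_ne_zero.2 (card_ne_zero_of_mem (mem_univ v)))
      have h2 : z = 0 := funext fun i => (h0 i v).trans h1
      have := hz.2
      simp [h2] at this
    · intro y hy
      by_cases hy0 : y = 0
      · simp [hy0]
      have h1 : 0 ≤ y ⬝ᵥ y := sum_nonneg fun i _ => mul_self_nonneg _
      have h2 : y ⬝ᵥ y ≠ 0 := fun h => hy0 (dotProduct_self_eq_zero.1 h)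
      have := hmin (hscale y hy hy0)
      simp only [Set.mem_ofPred_eq] at this
      rw [mulVec_smul, smul_dotProduct, dotProduct_smul, smul_eq_mul, smul_eq_mul, ← mul_assoc,
        ← mul_inv, Real.mul_self_sqrt h1, inv_mul_eq_div, le_div_iff₀ (lt_of_le_of_ne h1 h2.symm)]
        at this
      exact this

theorem sum_subtype_eq_sum_ite {V : Type*} [Fintype V] (S : Set V) [Fintype S]
    [DecidablePred (· ∈ S)] (f : V → ℝ) : ∑ u : S, f u = ∑ u, if u ∈ S then f u else 0 := by
  rw [← sum_filter, ← sum_subtype (univ.filter (· ∈ S)) (by simp) f]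

theorem HasGap.induce {V : Type*} [Fintype V] {G : SimpleGraph V} [DecidableRel G.Adj]
    {S : Set V} [Fintype S] [DecidablePred (· ∈ S)] {m : ℝ} (h : HasGap (G.induce S) m)
    (x : V → ℝ) (hx : (∑ u, if u ∈ S then x u else 0) = 0) :
    m * (∑ u, if u ∈ S then x u ^ 2 else 0) ≤
      (∑ u, ∑ v, if u ∈ S ∧ v ∈ S ∧ G.Adj u v then (x u - x v) ^ 2 else 0) / 2 := by
  classical
  have := h (fun u => x u) (by rw [sum_subtype_eq_sum_ite, hx])
  rw [dotProduct_laplacian_mulVec] at this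
  unfold dotProduct at this
  rw [sum_subtype_eq_sum_ite S fun u => x u * x u] at this
  simp only [SimpleGraph.comap_adj, Function.Embedding.subtype_apply] at this
  rw [sum_congr rfl fun (u : S) _ => sum_subtype_eq_sum_ite S fun v =>
      if G.Adj u v then (x u - x v) ^ 2 else 0,
    sum_subtype_eq_sum_ite S fun u => ∑ v, if v ∈ S then
      if G.Adj u v then (x u - x v) ^ 2 else 0 else 0] at this
  simp only [← sq] at this
  refine this.trans_eq ?_
  congr 1
  refine sum_congr rfl fun u _ => ?_
  by_cases hu : u ∈ S
  · simp only [hu, if_true, true_and]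
    exact sum_congr rfl fun v _ => by split_ifs <;> simp_all
  · simp [hu]

/-! ### The stiffness form as a sum over edges. -/

theorem mulVec_transpose_rigidityMatrix {V : Type*} [Fintype V] {d : ℕ} (G : SimpleGraph V)
    (p : V → EuclideanSpace ℝ (Fin d)) (f : V × Fin d → ℝ) {u v : V} (h : G.Adj u v) :
    ((rigidityMatrix G p)ᵀ *ᵥ f) ⟨s(u, v), h⟩ =
      ∑ k, (f (u, k) - f (v, k)) * unitDir p u v k := by
  classical
  simp only [mulVec, dotProduct, transpose_apply, rigidityMatrix, of_apply, Sym2.lift_mk, edgeVec]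
  rw [Fintype.sum_prod_type, sum_comm]
  refine sum_congr rfl fun k _ => ?_
  simp only [sub_mul, sum_sub_distrib, Pi.single_apply, ite_mul, one_mul, zero_mul,
    sum_ite_eq', mem_univ, if_true]
  simp [mul_comm]

theorem dotProduct_stiffnessMatrix_mulVec {V : Type*} [Fintype V] {d : ℕ} (G : SimpleGraph V)
    [DecidableRel G.Adj] (p : V → EuclideanSpace ℝ (Fin d)) (f : V × Fin d → ℝ) :
    f ⬝ᵥ (stiffnessMatrix G p *ᵥ f) =
      (∑ u, ∑ v, if G.Adj u v then (∑ k, (f (u, k) - f (v, k)) * unitDir p u v k) ^ 2 else 0)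
        / 2 := by
  classical
  let := Fintype.ofFinite G.edgeSet
  have h1 : f ⬝ᵥ (stiffnessMatrix G p *ᵥ f) =
      ∑ e, ((rigidityMatrix G p)ᵀ *ᵥ f) e ^ 2 := by
    unfold stiffnessMatrix
    rw [← mulVec_mulVec, dotProduct_mulVec, ← mulVec_transpose]
    exact sum_congr rfl fun e _ => (sq _).symm
  have h2 := sum_edgeSet_eq_half_sum_adj G fun e =>
    if he : e ∈ G.edgeSet then ((rigidityMatrix G p)ᵀ *ᵥ f) ⟨e, he⟩ ^ 2 else 0
  simp only [Subtype.coe_prop, dif_pos, Subtype.coe_eta] at h2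
  rw [h1, h2]
  congr 1
  refine sum_congr rfl fun u _ => sum_congr rfl fun v _ => ?_
  by_cases h : G.Adj u v
  · rw [if_pos h, if_pos h, dif_pos (by exact h), mulVec_transpose_rigidityMatrix G p f h]
  · rw [if_neg h, if_neg h]

/-! ### The limit form and its lower bound. -/

/-- The functionals whose vanishing puts the components of `f` along the coordinate sum and along
the differences of coordinates in the range where spectral gaps apply. -/
noncomputable def partitionConstraints {V : Type*} [Fintype V] {d : ℕ} (c : V → Fin d) :
    (V × Fin d → ℝ) →ₗ[ℝ] (Sym2 (Fin d) → ℝ) where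
  toFun f z :=
    if z.inf = z.sup then ∑ u, if c u = z.inf then ∑ k, f (u, k) else 0
    else ∑ u, if c u = z.inf ∨ c u = z.sup then f (u, z.inf) - f (u, z.sup) else 0
  map_add' f g := by
    funext z
    simp only [Pi.add_apply]
    split_ifs
    · rw [← sum_add_distrib]
      exact sum_congr rfl fun u _ => by split_ifs <;> simp [sum_add_distrib]
    · rw [← sum_add_distrib]
      exact sum_congr rfl fun u _ => by split_ifs <;> ring
  map_smul' a f := by
    funext z
    simp only [Pi.smul_apply, smul_eq_mul, RingHom.id_apply, mul_ite, mul_sum, mul_sub, mul_zero]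

theorem sum_eq_zero_of_partitionConstraints {V : Type*} [Fintype V] {d : ℕ} {c : V → Fin d}
    {f : V × Fin d → ℝ} (hf : partitionConstraints c f = 0) (i : Fin d) :
    (∑ u, if c u = i then ∑ k, f (u, k) else 0) = 0 := by
  have := congrFun hf s(i, i)
  simpa [partitionConstraints] using this

theorem sum_sub_eq_zero_of_partitionConstraints {V : Type*} [Fintype V] {d : ℕ} {c : V → Fin d}
    {f : V × Fin d → ℝ} (hf : partitionConstraints c f = 0) {i j : Fin d} (hij : i < j) :
    (∑ u, if c u = i ∨ c u = j then f (u, i) - f (u, j) else 0) = 0 := by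
  have := congrFun hf s(i, j)
  simpa [partitionConstraints, hij.le, hij.ne] using this

/-- The limit, as the points of each class merge, of the energy of an edge. -/
noncomputable def limitEnergy {V : Type*} {d : ℕ} (c : V → Fin d) (f : V × Fin d → ℝ) (u v : V) :
    ℝ :=
  if c u = c v then (∑ k, f (u, k) - ∑ k, f (v, k)) ^ 2 / d
  else ((f (u, c u) - f (u, c v)) - (f (v, c u) - f (v, c v))) ^ 2 / 2

theorem sum_adj_limitEnergy {V : Type*} [Fintype V] (G : SimpleGraph V) [DecidableRel G.Adj]
    {d : ℕ} (c : V → Fin d) (f : V × Fin d → ℝ) :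
    (∑ u, ∑ v, if G.Adj u v then limitEnergy c f u v else 0) =
      (∑ i, ∑ u, ∑ v, if c u = i ∧ c v = i ∧ G.Adj u v then
        (∑ k, f (u, k) - ∑ k, f (v, k)) ^ 2 else 0) / d +
      (∑ i, ∑ j, if i = j then 0 else ∑ u, ∑ v, if c u = i ∧ c v = j ∧ G.Adj u v then
        ((f (u, i) - f (u, j)) - (f (v, i) - f (v, j))) ^ 2 else 0) / 2 := by
  have h1 : (∑ i, ∑ u, ∑ v, if c u = i ∧ c v = i ∧ G.Adj u v then
        (∑ k, f (u, k) - ∑ k, f (v, k)) ^ 2 else 0) =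
      ∑ u, ∑ v, if c u = c v ∧ G.Adj u v then (∑ k, f (u, k) - ∑ k, f (v, k)) ^ 2 else 0 := by
    rw [sum_comm]
    refine sum_congr rfl fun u _ => ?_
    rw [sum_comm]
    refine sum_congr rfl fun v _ => ?_
    rw [sum_eq_single (c u)]
    · simp [eq_comm]
    · intro i _ hi
      rw [if_neg fun h => hi h.1.symm]
    · simp
  have h2 : (∑ i, ∑ j, if i = j then 0 else ∑ u, ∑ v, if c u = i ∧ c v = j ∧ G.Adj u v then
        ((f (u, i) - f (u, j)) - (f (v, i) - f (v, j))) ^ 2 else 0) =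
      ∑ u, ∑ v, if c u ≠ c v ∧ G.Adj u v then
        ((f (u, c u) - f (u, c v)) - (f (v, c u) - f (v, c v))) ^ 2 else 0 := by
    have : ∀ i j, (if i = j then 0 else ∑ u, ∑ v, if c u = i ∧ c v = j ∧ G.Adj u v then
        ((f (u, i) - f (u, j)) - (f (v, i) - f (v, j))) ^ 2 else 0) =
        ∑ u, ∑ v, if i ≠ j ∧ c u = i ∧ c v = j ∧ G.Adj u v then
        ((f (u, i) - f (u, j)) - (f (v, i) - f (v, j))) ^ 2 else 0 := by
      intro i j
      split_ifs with h <;> simp [h]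
    simp only [this]
    rw [sum_congr rfl fun i _ => sum_comm, sum_comm]
    refine sum_congr rfl fun u _ => ?_
    rw [sum_congr rfl fun i _ => sum_comm, sum_comm]
    refine sum_congr rfl fun v _ => ?_
    rw [sum_eq_single (c u), sum_eq_single (c v)]
    · simp
    · intro i _ hi
      rw [if_neg fun h => hi h.2.2.1.symm]
    · simp
    · intro i _ hi
      exact sum_eq_zero fun j _ => if_neg fun h => hi h.2.1.symm
    · simp
  rw [h1, h2, sum_div, sum_div, ← sum_add_distrib]
  refine sum_congr rfl fun u _ => ?_
  rw [sum_div, sum_div, ← sum_add_distrib]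
  refine sum_congr rfl fun v _ => ?_
  unfold limitEnergy
  by_cases ha : G.Adj u v <;> by_cases hc : c u = c v <;> simp [ha, hc]

/-- The right side orients each edge from class `i` to class `j`, so each edge counts once and the
usual division by two disappears. -/
theorem HasGap.bipartite {V : Type*} [Fintype V] {G : SimpleGraph V} [DecidableRel G.Adj]
    {d : ℕ} {c : V → Fin d} {i j : Fin d} (hij : i ≠ j) {m : ℝ}
    [Fintype ({u | c u = i} ∪ {u | c u = j} : Set V)]
    (h : HasGap (bipartiteBetween G {u | c u = i} {u | c u = j}) m) (x : V → ℝ)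
    (hx : (∑ u, if c u = i ∨ c u = j then x u else 0) = 0) :
    m * (∑ u, if c u = i ∨ c u = j then x u ^ 2 else 0) ≤
      ∑ u, ∑ v, if c u = i ∧ c v = j ∧ G.Adj u v then (x u - x v) ^ 2 else 0 := by
  classical
  have h1 := HasGap.induce h x (by simpa using hx)
  simp only [Set.mem_union, Set.mem_ofPred_eq, SimpleGraph.between_adj] at h1
  refine h1.trans_eq ?_
  have h2 : (∑ u, ∑ v, if c v = i ∧ c u = j ∧ G.Adj u v then (x u - x v) ^ 2 else 0) =
      ∑ u, ∑ v, if c u = i ∧ c v = j ∧ G.Adj u v then (x u - x v) ^ 2 else 0 := by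
    rw [sum_comm]
    refine sum_congr rfl fun u _ => sum_congr rfl fun v _ => ?_
    simp only [G.adj_comm v u, sub_sq_comm (x v) (x u)]
  rw [div_eq_iff two_ne_zero, mul_two]
  nth_rewrite 2 [← h2]
  rw [← sum_add_distrib]
  refine sum_congr rfl fun u _ => ?_
  rw [← sum_add_distrib]
  refine sum_congr rfl fun v _ => ?_
  by_cases ha : G.Adj u v <;> by_cases h1 : c u = i <;> by_cases h2 : c u = j <;>
    by_cases h3 : c v = i <;> by_cases h4 : c v = j <;> simp_all

/-- The gaps are summed over all classes and pairs, and the result is compared with `f ⬝ᵥ f` one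
vertex at a time; `hframe` is that comparison at a vertex of class `i`. -/
theorem limit_form_ge {V : Type*} [Fintype V] (G : SimpleGraph V) [DecidableRel G.Adj]
    {d : ℕ} (hd : d ≠ 0) (c : V → Fin d) {m m₂ : ℝ}
    (h₁ : ∀ i (_ : Fintype {u | c u = i}), HasGap (G.induce {u | c u = i}) m)
    (h₂ : ∀ i j, i < j → ∀ (_ : Fintype ({u | c u = i} ∪ {u | c u = j} : Set V)),
      HasGap (bipartiteBetween G {u | c u = i} {u | c u = j}) m₂)
    (hframe : ∀ x : Fin d → ℝ, ∑ k, x k = 0 → ∀ i,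
      m * ∑ k, x k ^ 2 ≤ m₂ * ((∑ j, (x i - x j) ^ 2) / 2))
    {f : V × Fin d → ℝ} (hf : partitionConstraints c f = 0) :
    m * (f ⬝ᵥ f) ≤ (∑ u, ∑ v, if G.Adj u v then limitEnergy c f u v else 0) / 2 := by
  classical
  rw [sum_adj_limitEnergy]
  have hd' : (0 : ℝ) < d := by positivity
  have e1 : ∀ i, m * (∑ u, if c u = i then (∑ k, f (u, k)) ^ 2 else 0) ≤
      (∑ u, ∑ v, if c u = i ∧ c v = i ∧ G.Adj u v then
        (∑ k, f (u, k) - ∑ k, f (v, k)) ^ 2 else 0) / 2 := by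
    intro i
    have := (h₁ i inferInstance).induce (fun u => ∑ k, f (u, k))
      (by simpa using sum_eq_zero_of_partitionConstraints hf i)
    simpa using this
  have e2lt : ∀ i j, i < j →
      m₂ * (∑ u, if c u = i ∨ c u = j then (f (u, i) - f (u, j)) ^ 2 else 0) ≤
      ∑ u, ∑ v, if c u = i ∧ c v = j ∧ G.Adj u v then
        ((f (u, i) - f (u, j)) - (f (v, i) - f (v, j))) ^ 2 else 0 := by
    intro i j hij
    exact (h₂ i j hij inferInstance).bipartite hij.ne (fun u => f (u, i) - f (u, j))
      (sum_sub_eq_zero_of_partitionConstraints hf hij)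
  have e2 : ∀ i j,
      m₂ * (∑ u, if c u = i ∨ c u = j then (f (u, i) - f (u, j)) ^ 2 else 0) ≤
      if i = j then 0 else ∑ u, ∑ v, if c u = i ∧ c v = j ∧ G.Adj u v then
        ((f (u, i) - f (u, j)) - (f (v, i) - f (v, j))) ^ 2 else 0 := by
    intro i j
    rcases lt_trichotomy i j with h | h | h
    · rw [if_neg h.ne]
      exact e2lt i j h
    · simp [h]
    · rw [if_neg h.ne']
      refine le_of_eq_of_le ?_ ((e2lt j i h).trans_eq ?_)
      · congr 1
        refine sum_congr rfl fun u _ => ?_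
        simp only [or_comm (a := c u = i), sub_sq_comm (f (u, i))]
      · rw [sum_comm]
        refine sum_congr rfl fun u _ => sum_congr rfl fun v _ => ?_
        have : (c v = j ∧ c u = i ∧ G.Adj v u) ↔ (c u = i ∧ c v = j ∧ G.Adj u v) := by
          rw [G.adj_comm]; tauto
        simp only [this]
        congr 1
        ring
  have s1 : (∑ i, ∑ u, if c u = i then (∑ k, f (u, k)) ^ 2 else 0) =
      ∑ u, (∑ k, f (u, k)) ^ 2 := by
    rw [sum_comm]
    simp
  have s2 : (∑ i, ∑ j, ∑ u, if c u = i ∨ c u = j then (f (u, i) - f (u, j)) ^ 2 else 0) =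
      ∑ u, 2 * ∑ j, (f (u, c u) - f (u, j)) ^ 2 := by
    rw [sum_congr rfl fun i _ => sum_comm, sum_comm]
    refine sum_congr rfl fun u _ => ?_
    have : ∀ i j, (if c u = i ∨ c u = j then (f (u, i) - f (u, j)) ^ 2 else 0) =
        (if c u = i then (f (u, i) - f (u, j)) ^ 2 else 0) +
        if c u = j then (f (u, i) - f (u, j)) ^ 2 else 0 := by
      intro i j
      by_cases h1 : c u = i <;> by_cases h2 : c u = j
      · simp [← h1, ← h2]
      all_goals aesop
    simp only [this, sum_add_distrib]
    rw [two_mul]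
    congr 1
    · rw [sum_comm]
      simp
    · simp only [sum_ite_eq, mem_univ, if_true]
      exact sum_congr rfl fun i _ => by ring
  have t1 := sum_le_sum fun i (_ : i ∈ univ) => e1 i
  rw [← mul_sum, s1, ← sum_div] at t1
  have t2 := sum_le_sum fun i (_ : i ∈ univ) => sum_le_sum fun j (_ : j ∈ univ) => e2 i j
  simp only [← mul_sum] at t2
  rw [s2, ← mul_sum] at t2
  have t3 : m * (f ⬝ᵥ f) ≤ m * (∑ u, (∑ k, f (u, k)) ^ 2) / d +
      m₂ * (∑ u, ∑ j, (f (u, c u) - f (u, j)) ^ 2) / 2 := by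
    have : f ⬝ᵥ f = ∑ u, ∑ k, f (u, k) ^ 2 := by
      simp only [dotProduct, Fintype.sum_prod_type, sq]
    rw [this, mul_sum, mul_sum, mul_sum, sum_div, sum_div, ← sum_add_distrib]
    refine sum_le_sum fun u _ => ?_
    set s := ∑ k, f (u, k) with hs
    -- Orthogonal splitting of `f (u, ·)`: the part along the all-ones vector has squared norm `s ^
    -- 2 / d`, and the differences of coordinates only see the sum-zero part.
    have hx := hframe (fun k => f (u, k) - s / d) (by
      simp only [sum_sub_distrib, sum_const, card_univ, Fintype.card_fin, nsmul_eq_mul, ← hs]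
      field_simp
      ring) (c u)
    have hsq : ∑ k, (f (u, k) - s / d) ^ 2 = ∑ k, f (u, k) ^ 2 - s ^ 2 / d := by
      simp only [sub_sq, sum_add_distrib, sum_sub_distrib, ← sum_mul, ← mul_sum, sum_const,
        card_univ, Fintype.card_fin, nsmul_eq_mul, ← hs]
      field_simp
      ring
    simp only [sub_sub_sub_cancel_right] at hx
    rw [hsq] at hx
    have : m * (s ^ 2) / d = m * (s ^ 2 / d) := by ring
    rw [this]
    linarith
  have t4 := div_le_div_of_nonneg_right t1 hd'.le
  have t5 : ∀ a b : ℝ, (a / d + b / 2) / 2 = a / 2 / d + b / 4 := fun a b => by ring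
  rw [t5]
  linarith

/-! ### Placements near the vertices of the simplex. -/

theorem norm_unitDir_le_one {V : Type*} {d : ℕ} (p : V → EuclideanSpace ℝ (Fin d)) (u v : V) :
    ‖unitDir p u v‖ ≤ 1 := by
  unfold unitDir
  rw [norm_smul, norm_inv, norm_norm]
  exact inv_mul_le_one

/-- The points `e_{c u}` shifted along the all-ones vector by `t * g u`. -/
noncomputable def shiftedVertices {V : Type*} {d : ℕ} (c : V → Fin d) (g : V → ℝ) (t : ℝ) (u : V) :
    EuclideanSpace ℝ (Fin d) :=
  EuclideanSpace.single (c u) 1 + (t * g u) • WithLp.toLp 2 (fun _ => 1)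

/-- Inside a class the direction is the normalized all-ones vector up to sign, so the limit energy
is attained exactly for every `t ≠ 0`. -/
theorem inner_unitDir_shiftedVertices_sq {V : Type*} {d : ℕ} (hd : d ≠ 0) {c : V → Fin d}
    {g : V → ℝ} {t : ℝ} (ht : t ≠ 0) {u v : V} (hc : c u = c v) (hg : g u ≠ g v)
    (x : EuclideanSpace ℝ (Fin d)) :
    inner ℝ x (unitDir (shiftedVertices c g t) u v) ^ 2 = (∑ k, x k) ^ 2 / d := by
  have h1 : shiftedVertices c g t u - shiftedVertices c g t v =
      (t * (g u - g v)) • WithLp.toLp 2 (fun _ => 1) := by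
    unfold shiftedVertices
    rw [hc]
    module
  have h2 : t * (g u - g v) ≠ 0 := mul_ne_zero ht (sub_ne_zero.2 hg)
  have h3 : inner ℝ x (WithLp.toLp 2 (fun _ => 1) : EuclideanSpace ℝ (Fin d)) = ∑ k, x k := by
    simp [PiLp.inner_apply]
  have h4 : ‖(WithLp.toLp 2 (fun _ => 1) : EuclideanSpace ℝ (Fin d))‖ ^ 2 = d := by
    simp [EuclideanSpace.real_norm_sq_eq]
  have hd' : (d : ℝ) ≠ 0 := Nat.cast_ne_zero.2 hd
  unfold unitDir
  rw [h1, inner_smul_right, inner_smul_right, h3, norm_smul, mul_pow, mul_pow, inv_pow, mul_pow,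
    h4, Real.norm_eq_abs, sq_abs]
  field_simp

theorem shiftedVertices_zero {V : Type*} {d : ℕ} (c : V → Fin d) (g : V → ℝ) (u : V) :
    shiftedVertices c g 0 u = EuclideanSpace.single (c u) 1 := by
  simp [shiftedVertices]

theorem inner_unitDir_single_sq {V : Type*} {d : ℕ} {c : V → Fin d}
    {g : V → ℝ} {u v : V} (hc : c u ≠ c v) (x : EuclideanSpace ℝ (Fin d)) :
    inner ℝ x (unitDir (shiftedVertices c g 0) u v) ^ 2 = (x (c u) - x (c v)) ^ 2 / 2 := by
  unfold unitDir
  rw [shiftedVertices_zero, shiftedVertices_zero]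
  have h4 : ‖(EuclideanSpace.single (c u) 1 - EuclideanSpace.single (c v) 1 :
      EuclideanSpace ℝ (Fin d))‖ ^ 2 = 2 := by
    rw [@norm_sub_sq ℝ]
    simp [EuclideanSpace.inner_single_left, hc]
    norm_num
  rw [inner_smul_right, inner_sub_right, EuclideanSpace.inner_single_right,
    EuclideanSpace.inner_single_right, mul_pow, inv_pow, h4]
  simp
  ring

theorem continuousAt_unitDir_shiftedVertices {V : Type*} {d : ℕ} {c : V → Fin d}
    {g : V → ℝ} {u v : V} (hc : c u ≠ c v) :
    ContinuousAt (fun t => unitDir (shiftedVertices c g t) u v) 0 := by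
  have h1 : Continuous fun t => shiftedVertices c g t u - shiftedVertices c g t v := by
    unfold shiftedVertices
    fun_prop
  refine ContinuousAt.smul (ContinuousAt.inv₀ h1.norm.continuousAt ?_) h1.continuousAt
  rw [shiftedVertices_zero, shiftedVertices_zero, norm_ne_zero_iff, sub_ne_zero]
  intro h
  have := congrArg (fun x : EuclideanSpace ℝ (Fin d) => x (c u)) h
  simp [hc] at this

/-- Factoring the difference of squares gives an error proportional to `‖x‖ ^ 2`, hence an
approximation uniform in the vector field. -/
theorem inner_sq_sub_le {E : Type*} [NormedAddCommGroup E] [InnerProductSpace ℝ E] {x a b : E}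
    (ha : ‖a‖ ≤ 1) (hb : ‖b‖ ≤ 1) :
    inner ℝ x b ^ 2 - 2 * ‖a - b‖ * ‖x‖ ^ 2 ≤ inner ℝ x a ^ 2 := by
  have h1 : inner ℝ x b ^ 2 - inner ℝ x a ^ 2 = inner ℝ x (b - a) * inner ℝ x (b + a) := by
    rw [inner_sub_right, inner_add_right]
    ring
  have h2 : |inner ℝ x (b - a) * inner ℝ x (b + a)| ≤ (‖x‖ * ‖a - b‖) * (‖x‖ * 2) := by
    rw [abs_mul, norm_sub_rev]
    refine mul_le_mul (abs_real_inner_le_norm _ _) ((abs_real_inner_le_norm _ _).trans ?_)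
      (abs_nonneg _) (by positivity)
    refine mul_le_mul_of_nonneg_left ((norm_add_le _ _).trans ?_) (norm_nonneg _)
    linarith
  have h3 := (le_abs_self _).trans h2
  rw [← h1] at h3
  linarith

/-- Placements near the vertices of the standard simplex whose edge energies approximate the limit
energies. -/
theorem exists_placement {V : Type*} [Fintype V] {d : ℕ} (hd : d ≠ 0) {c : V → Fin d}
    (hc : Function.Surjective c) {ε : ℝ} (hε : 0 < ε) :
    ∃ p : V → EuclideanSpace ℝ (Fin d), (∀ i, ∃ u, p u = EuclideanSpace.single i 1) ∧
      ∀ (f : V × Fin d → ℝ) (u v : V), u ≠ v →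
        limitEnergy c f u v - ε * ∑ k, (f (u, k) - f (v, k)) ^ 2 ≤
          (∑ k, (f (u, k) - f (v, k)) * unitDir p u v k) ^ 2 := by
  classical
  choose rep hrep using hc
  let e : V → ℝ := fun u => (Fintype.equivFin V u : ℕ)
  have he : Function.Injective e := fun u v h =>
    (Fintype.equivFin V).injective (Fin.ext (Nat.cast_injective h))
  -- Injective on each class, and zero at the representatives, which therefore sit exactly at the
  -- simplex vertices.
  let g : V → ℝ := fun u => e u - e (rep (c u))
  have hev : ∀ᶠ t in nhds (0 : ℝ), ∀ u v, c u ≠ c v →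
      ‖unitDir (shiftedVertices c g t) u v - unitDir (shiftedVertices c g 0) u v‖ < ε / 2 := by
    rw [Filter.eventually_all]
    intro u
    rw [Filter.eventually_all]
    intro v
    by_cases h : c u = c v
    · simp [h]
    · have := Metric.continuousAt_iff'.1
        (continuousAt_unitDir_shiftedVertices (g := g) h) (ε / 2) (half_pos hε)
      filter_upwards [this] with t ht _
      rwa [dist_eq_norm] at ht
  obtain ⟨t, ht, ht0⟩ := ((hev.filter_mono nhdsWithin_le_nhds).and
    (self_mem_nhdsWithin (a := (0 : ℝ)) (s := {0}ᶜ))).exists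
  refine ⟨shiftedVertices c g t, fun i => ⟨rep i, ?_⟩, fun f u v huv => ?_⟩
  · simp [shiftedVertices, g, hrep]
  set x : EuclideanSpace ℝ (Fin d) := WithLp.toLp 2 fun k => f (u, k) - f (v, k) with hx
  have h1 : ∑ k, (f (u, k) - f (v, k)) * unitDir (shiftedVertices c g t) u v k =
      inner ℝ x (unitDir (shiftedVertices c g t) u v) := by
    simp [PiLp.inner_apply, hx, mul_comm]
  have h2 : ∑ k, (f (u, k) - f (v, k)) ^ 2 = ‖x‖ ^ 2 := by
    simp [EuclideanSpace.real_norm_sq_eq, hx]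
  rw [h1, h2]
  unfold limitEnergy
  split_ifs with h
  · rw [inner_unitDir_shiftedVertices_sq hd ht0 h]
    · simp only [hx, sum_sub_distrib]
      have : 0 ≤ ε * ‖x‖ ^ 2 := by positivity
      linarith
    · simp only [g, h]
      exact fun h' => huv (he (sub_left_injective h'))
  · refine le_trans ?_ (inner_sq_sub_le (norm_unitDir_le_one _ u v)
      (norm_unitDir_le_one (shiftedVertices c g 0) u v))
    rw [inner_unitDir_single_sq h]
    have h3 : 2 * ‖unitDir (shiftedVertices c g t) u v - unitDir (shiftedVertices c g 0) u v‖ *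
        ‖x‖ ^ 2 ≤ ε * ‖x‖ ^ 2 :=
      mul_le_mul_of_nonneg_right (by linarith [ht u v h]) (sq_nonneg _)
    have h4 : (x (c u) - x (c v)) ^ 2 =
        ((f (u, c u) - f (u, c v)) - (f (v, c u) - f (v, c v))) ^ 2 := by
      simp only [hx]
      ring
    rw [h4]
    linarith

theorem exists_stiffness_form_ge {V : Type*} [Fintype V] (G : SimpleGraph V)
    {d : ℕ} (hd : d ≠ 0) {c : V → Fin d} (hc : Function.Surjective c) {m m₂ : ℝ}
    (h₁ : ∀ i (_ : Fintype {u | c u = i}), HasGap (G.induce {u | c u = i}) m)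
    (h₂ : ∀ i j, i < j → ∀ (_ : Fintype ({u | c u = i} ∪ {u | c u = j} : Set V)),
      HasGap (bipartiteBetween G {u | c u = i} {u | c u = j}) m₂)
    (hframe : ∀ x : Fin d → ℝ, ∑ k, x k = 0 → ∀ i,
      m * ∑ k, x k ^ 2 ≤ m₂ * ((∑ j, (x i - x j) ^ 2) / 2))
    {m' : ℝ} (hm' : m' < m) :
    ∃ p : V → EuclideanSpace ℝ (Fin d), (∀ i, ∃ u, p u = EuclideanSpace.single i 1) ∧
      ∀ f, partitionConstraints c f = 0 → m' * (f ⬝ᵥ f) ≤ f ⬝ᵥ (stiffnessMatrix G p *ᵥ f) := by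
  classical
  set n : ℝ := (Fintype.card V : ℝ) with hn
  have hn0 : 0 ≤ n := Nat.cast_nonneg _
  -- By `(a - b)² ≤ 2a² + 2b²`, the errors over ordered pairs sum to at most `4 * n * ε * (f ⬝ᵥ f)`,
  -- which is then halved. The `+ 1` keeps the denominator positive.
  set ε := (m - m') / (2 * n + 1) with hε
  have hε0 : 0 < ε := div_pos (sub_pos.2 hm') (by positivity)
  obtain ⟨p, hp, hpe⟩ := exists_placement hd hc hε0
  refine ⟨p, hp, fun f hf => ?_⟩
  have e1 := limit_form_ge G hd c h₁ h₂ hframe hf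
  rw [dotProduct_stiffnessMatrix_mulVec]
  have hself : f ⬝ᵥ f = ∑ u, ∑ k, f (u, k) ^ 2 := by
    simp only [dotProduct, Fintype.sum_prod_type, sq]
  have hnn : 0 ≤ f ⬝ᵥ f := sum_nonneg fun _ _ => mul_self_nonneg _
  have e2 : (∑ u, ∑ v, if G.Adj u v then limitEnergy c f u v else 0) - ε * (4 * n * (f ⬝ᵥ f)) ≤
      ∑ u, ∑ v, if G.Adj u v then (∑ k, (f (u, k) - f (v, k)) * unitDir p u v k) ^ 2 else 0 := by
    have e3 : 4 * n * (f ⬝ᵥ f) =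
        ∑ u, ∑ v, (2 * ∑ k, f (u, k) ^ 2 + 2 * ∑ k, f (v, k) ^ 2) := by
      simp only [sum_add_distrib, sum_const, card_univ, nsmul_eq_mul, ← mul_sum, ← hself, ← hn]
      ring
    rw [e3, mul_sum, ← sum_sub_distrib]
    refine sum_le_sum fun u _ => ?_
    rw [mul_sum, ← sum_sub_distrib]
    refine sum_le_sum fun v _ => ?_
    have e5 : ∑ k, (f (u, k) - f (v, k)) ^ 2 ≤ 2 * ∑ k, f (u, k) ^ 2 + 2 * ∑ k, f (v, k) ^ 2 := by
      rw [mul_sum, mul_sum, ← sum_add_distrib]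
      exact sum_le_sum fun k _ => by nlinarith [sq_nonneg (f (u, k) + f (v, k))]
    have e6 := mul_le_mul_of_nonneg_left e5 hε0.le
    split_ifs with h
    · linarith [hpe f u v h.ne]
    · have : 0 ≤ ε * (2 * ∑ k, f (u, k) ^ 2 + 2 * ∑ k, f (v, k) ^ 2) := by positivity
      linarith
  have e4 : ε * (2 * n + 1) = m - m' := div_mul_cancel₀ _ (by positivity)
  have e5 : ε * (2 * n) * (f ⬝ᵥ f) ≤ (m - m') * (f ⬝ᵥ f) :=
    mul_le_mul_of_nonneg_right (by linarith) hnn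
  linarith

/-! ### Infinitesimal isometries and the rank of the rigidity matrix. -/

/-- The velocities of the infinitesimal isometries of `ℝᵈ` at the points `p u`: the diagonal
coordinates of `a` give the translation, the off-diagonal ones the skew-symmetric matrix. -/
noncomputable def infinitesimalIsometries {V : Type*} {d : ℕ} (p : V → EuclideanSpace ℝ (Fin d)) :
    (Sym2 (Fin d) → ℝ) →ₗ[ℝ] (V × Fin d → ℝ) where
  toFun a x := a s(x.2, x.2) +
    ∑ j, (if x.2 < j then 1 else if j < x.2 then -1 else 0) * a s(x.2, j) * p x.1 j
  map_add' a b := by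
    funext x
    simp only [Pi.add_apply, mul_add, add_mul, sum_add_distrib]
    ring
  map_smul' r a := by
    funext x
    simp only [Pi.smul_apply, smul_eq_mul, RingHom.id_apply, mul_add, mul_sum]
    congr 1
    exact sum_congr rfl fun j _ => by ring

theorem infinitesimalIsometries_injective {V : Type*} {d : ℕ} {p : V → EuclideanSpace ℝ (Fin d)}
    (hp : ∀ i, ∃ u, p u = EuclideanSpace.single i 1) :
    Function.Injective (infinitesimalIsometries p) := by
  rw [← LinearMap.ker_eq_bot, LinearMap.ker_eq_bot']
  intro a ha
  -- Evaluation at the point `e_k` reads off the `k`-th column of the skew matrix plus the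
  -- translation; `k = i` isolates the translation.
  have h1 : ∀ k i, a s(i, i) + (if i < k then 1 else if k < i then -1 else 0) * a s(i, k) = 0 := by
    intro k i
    obtain ⟨u, hu⟩ := hp k
    have := congrFun ha (u, i)
    simp only [infinitesimalIsometries, LinearMap.coe_mk, AddHom.coe_mk, hu, PiLp.single_apply,
      mul_ite, mul_one, mul_zero, sum_ite_eq', mem_univ, if_true, Pi.zero_apply] at this
    exact this
  have h2 : ∀ i, a s(i, i) = 0 := fun i => by simpa using h1 i i
  funext z
  induction z with
  | _ i k =>
    have := h1 k i
    rw [h2, zero_add] at this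
    rcases lt_trichotomy i k with h | h | h
    · simpa [h] using this
    · rw [h]
      exact h2 k
    · simpa [h, h.not_gt] using this

theorem mulVec_infinitesimalIsometries {V : Type*} [Fintype V] {d : ℕ} (G : SimpleGraph V)
    (p : V → EuclideanSpace ℝ (Fin d)) (a : Sym2 (Fin d) → ℝ) :
    (rigidityMatrix G p)ᵀ *ᵥ infinitesimalIsometries p a = 0 := by
  funext ⟨z, hz⟩
  induction z with
  | _ u v =>
    rw [mulVec_transpose_rigidityMatrix G p _ hz, Pi.zero_apply]
    have h1 : ∀ k, infinitesimalIsometries p a (u, k) - infinitesimalIsometries p a (v, k) =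
        ∑ j, (if k < j then 1 else if j < k then -1 else 0) * a s(k, j) * (p u - p v) j := by
      intro k
      simp [infinitesimalIsometries, mul_sub, sum_sub_distrib]
    simp only [h1, unitDir, PiLp.smul_apply, smul_eq_mul, sum_mul]
    set x := p u - p v
    -- A skew-symmetric form vanishes on the diagonal: exchanging the indices changes the sign.
    have h2 : (∑ k, ∑ j, (if k < j then 1 else if j < k then -1 else 0) * a s(k, j) * x j *
          (‖x‖⁻¹ * x k)) =
        -∑ k, ∑ j, (if k < j then 1 else if j < k then -1 else 0) * a s(k, j) * x j *
          (‖x‖⁻¹ * x k) := by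
      conv_lhs => rw [sum_comm]
      simp only [← sum_neg_distrib]
      refine sum_congr rfl fun k _ => sum_congr rfl fun j _ => ?_
      rw [Sym2.eq_swap]
      rcases lt_trichotomy j k with h | h | h
      · simp only [h, h.not_gt, if_true, if_false]
        ring
      · simp [h]
      · simp only [h, h.not_gt, if_true, if_false]
        ring
    linarith

/-- Both the constraints and the infinitesimal isometries are indexed by `Sym2 (Fin d)`, which
yields `binom(d+1, 2)` on each side of the rank count. -/
theorem card_sym2_fin (d : ℕ) : Fintype.card (Sym2 (Fin d)) = (d + 1).choose 2 := by
  rw [Sym2.card, Fintype.card_fin]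

theorem rank_rigidityMatrix_add_le {V : Type*} [Fintype V] {d : ℕ} (G : SimpleGraph V)
    [Fintype G.edgeSet] {p : V → EuclideanSpace ℝ (Fin d)}
    (hp : ∀ i, ∃ u, p u = EuclideanSpace.single i 1) :
    (rigidityMatrix G p).rank + (d + 1).choose 2 ≤ d * Nat.card V := by
  have h1 := ((rigidityMatrix G p)ᵀ.mulVecLin).finrank_range_add_finrank_ker
  have h2 : Module.finrank ℝ (Sym2 (Fin d) → ℝ) ≤
      Module.finrank ℝ (LinearMap.ker (rigidityMatrix G p)ᵀ.mulVecLin) :=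
    LinearMap.finrank_le_finrank_of_injective
      (f := (infinitesimalIsometries p).codRestrict _ fun a => by
        rw [LinearMap.mem_ker, mulVecLin_apply, mulVec_infinitesimalIsometries])
      ((LinearMap.injective_codRestrict_iff _).2 (infinitesimalIsometries_injective hp))
  rw [Module.finrank_fintype_fun_eq_card, card_sym2_fin] at h2
  rw [Module.finrank_fintype_fun_eq_card, Fintype.card_prod, Fintype.card_fin, ← Matrix.rank,
    rank_transpose] at h1
  rw [Nat.card_eq_fintype_card, mul_comm]
  omega

/-- Coercivity on the kernel of `T` makes `T` injective on the kernel of the stiffness matrix, whose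
rank is that of the rigidity matrix. -/
theorem le_rank_rigidityMatrix_add {V : Type*} [Fintype V] {d : ℕ} (G : SimpleGraph V)
    [Fintype G.edgeSet] {p : V → EuclideanSpace ℝ (Fin d)}
    (T : (V × Fin d → ℝ) →ₗ[ℝ] (Sym2 (Fin d) → ℝ)) {m : ℝ} (hm : 0 < m)
    (h : ∀ f, T f = 0 → m * (f ⬝ᵥ f) ≤ f ⬝ᵥ (stiffnessMatrix G p *ᵥ f)) :
    d * Nat.card V ≤ (rigidityMatrix G p).rank + (d + 1).choose 2 := by
  have hS : stiffnessMatrix G p = rigidityMatrix G p * (rigidityMatrix G p)ᵀ := by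
    unfold stiffnessMatrix
    congr!
  have h1 := ((stiffnessMatrix G p).mulVecLin).finrank_range_add_finrank_ker
  have h2 : Module.finrank ℝ (LinearMap.ker (stiffnessMatrix G p).mulVecLin) ≤
      Module.finrank ℝ (Sym2 (Fin d) → ℝ) := by
    refine LinearMap.finrank_le_finrank_of_injective
      (f := T.domRestrict (LinearMap.ker (stiffnessMatrix G p).mulVecLin)) ?_
    rw [← LinearMap.ker_eq_bot, LinearMap.ker_eq_bot']
    rintro ⟨f, hf⟩ hTf
    have h3 := h f hTf
    rw [LinearMap.mem_ker, mulVecLin_apply] at hf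
    rw [hf, dotProduct_zero] at h3
    have h4 : 0 ≤ f ⬝ᵥ f := sum_nonneg fun _ _ => mul_self_nonneg _
    have h5 : f ⬝ᵥ f = 0 := by nlinarith
    exact Subtype.ext (dotProduct_self_eq_zero.1 h5)
  rw [Module.finrank_fintype_fun_eq_card, card_sym2_fin] at h2
  rw [Module.finrank_fintype_fun_eq_card, Fintype.card_prod, Fintype.card_fin, ← Matrix.rank,
    hS, rank_self_mul_transpose, ← hS] at h1
  rw [Nat.card_eq_fintype_card, mul_comm]
  omega

/-! ### Frame bounds and conclusion. -/

theorem sum_sub_sq_eq {d : ℕ} {x : Fin d → ℝ} (hx : ∑ k, x k = 0) (i : Fin d) :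
    ∑ j, (x i - x j) ^ 2 = d * x i ^ 2 + ∑ k, x k ^ 2 := by
  simp only [sub_sq, sum_add_distrib, sum_sub_distrib, ← mul_sum, hx, sum_const, card_univ,
    Fintype.card_fin, nsmul_eq_mul]
  ring

/-- The term `d * x i ^ 2` is dropped, since `x i` may vanish. This is the source of the factor
`1/2` in the theorem. -/
theorem frame_bound {d : ℕ} {m : ℝ} (hm : 0 ≤ m) {x : Fin d → ℝ} (hx : ∑ k, x k = 0) (i : Fin d) :
    m * ∑ k, x k ^ 2 ≤ 2 * m * ((∑ j, (x i - x j) ^ 2) / 2) := by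
  rw [sum_sub_sq_eq hx]
  have : 0 ≤ m * (d * x i ^ 2) := by positivity
  linarith

/-- Here `x 1 = -x 0`, so `2 * x i ^ 2` equals `∑ k, x k ^ 2`: equality holds and nothing is lost.
-/
theorem frame_bound_two {m : ℝ} {x : Fin 2 → ℝ} (hx : ∑ k, x k = 0) (i : Fin 2) :
    m * ∑ k, x k ^ 2 ≤ m * ((∑ j, (x i - x j) ^ 2) / 2) := by
  rw [sum_sub_sq_eq hx, Fin.sum_univ_two]
  rw [Fin.sum_univ_two] at hx
  have h : x 1 = -x 0 := by linarith
  fin_cases i <;> simp [h] <;> apply le_of_eq <;> ring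

theorem le_algConnDim {V : Type*} [Fintype V] (G : SimpleGraph V)
    {d : ℕ} (hd : d ≠ 0) {c : V → Fin d} (hc : Function.Surjective c) {m m₂ : ℝ}
    (h₁ : ∀ i (_ : Fintype {u | c u = i}), HasGap (G.induce {u | c u = i}) m)
    (h₂ : ∀ i j, i < j → ∀ (_ : Fintype ({u | c u = i} ∪ {u | c u = j} : Set V)),
      HasGap (bipartiteBetween G {u | c u = i} {u | c u = j}) m₂)
    (hframe : ∀ x : Fin d → ℝ, ∑ k, x k = 0 → ∀ i,
      m * ∑ k, x k ^ 2 ≤ m₂ * ((∑ j, (x i - x j) ^ 2) / 2))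
    {m' : ℝ} (hm' : m' < m) : (m' : EReal) ≤ algConnDim d G := by
  obtain ⟨p, -, h⟩ := exists_stiffness_form_ge G hd hc h₁ h₂ hframe hm'
  have := le_lam_of_rayleigh (stiffnessMatrix_isHermitian G p) _ h
  rw [card_sym2_fin] at this
  exact this.trans (le_iSup (fun p : V → EuclideanSpace ℝ (Fin d) =>
    lam (stiffnessMatrix G p) (stiffnessMatrix_isHermitian G p) ((d + 1).choose 2 + 1)) p)

theorem isRigid_of_connected {V : Type*} [Fintype V] (G : SimpleGraph V)
    {d : ℕ} (hd : d ≠ 0) {c : V → Fin d} (hc : Function.Surjective c)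
    (h₁ : ∀ i, (G.induce {u | c u = i}).Connected)
    (h₂ : ∀ i j, i < j → (bipartiteBetween G {u | c u = i} {u | c u = j}).Connected) :
    IsRigid d G := by
  classical
  -- Gaps persist when the constant decreases, so finitely many positive gaps share a small positive
  -- one. The pairs need `2 * m` because of `frame_bound`.
  have e1 : ∀ᶠ m in nhdsWithin (0 : ℝ) (Set.Ioi 0), ∀ i, HasGap (G.induce {u | c u = i}) m := by
    rw [Filter.eventually_all]
    intro i
    obtain ⟨m, hm, h⟩ := exists_hasGap_of_connected (h₁ i)
    filter_upwards [Ioo_mem_nhdsGT hm] with r hr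
    exact h.mono hr.2.le
  have e2 : ∀ᶠ m in nhdsWithin (0 : ℝ) (Set.Ioi 0), ∀ i j, i < j →
      HasGap (bipartiteBetween G {u | c u = i} {u | c u = j}) (2 * m) := by
    rw [Filter.eventually_all]
    intro i
    rw [Filter.eventually_all]
    intro j
    by_cases hij : i < j
    · obtain ⟨m, hm, h⟩ := exists_hasGap_of_connected (h₂ i j hij)
      filter_upwards [Ioo_mem_nhdsGT (half_pos hm)] with r hr _
      exact h.mono (by linarith [hr.2])
    · simp [hij]
  obtain ⟨m, ⟨g1, g2⟩, hm⟩ := ((e1.and e2).and self_mem_nhdsWithin).exists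
  replace hm : 0 < m := hm
  obtain ⟨p, hp, h⟩ := exists_stiffness_form_ge G hd hc
    (fun i _ => by convert g1 i) (fun i j hij _ => by convert g2 i j hij)
    (fun x hx i => frame_bound hm.le hx i) (half_lt_self hm)
  let := Fintype.ofFinite G.edgeSet
  exact ⟨p, le_antisymm (rank_rigidityMatrix_add_le G hp)
    (le_rank_rigidityMatrix_add G _ (half_pos hm) h)⟩

theorem two_mul_le_of_le_half_mul {m : ℝ} {a : EReal} (h : (m : EReal) ≤ ((1 / 2 : ℝ) : EReal) * a) :
    ((2 * m : ℝ) : EReal) ≤ a := by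
  induction a with
  | bot =>
    rw [EReal.coe_mul_bot_of_pos (by norm_num)] at h
    exact absurd h (not_le.2 (EReal.bot_lt_coe m))
  | top => exact le_top
  | coe a =>
    rw [← EReal.coe_mul, EReal.coe_le_coe_iff] at h
    rw [EReal.coe_le_coe_iff]
    linarith

theorem min_le_algConnDim {V : Type*} [Fintype V] (G : SimpleGraph V)
    {d : ℕ} (hd : d ≠ 0) {c : V → Fin d} (hc : Function.Surjective c) {a : EReal} {r : ℝ}
    (h₁ : ∀ i, a ≤ algConn (G.induce {u | c u = i}))
    (h₂ : ∀ i j, i < j → ∀ m : ℝ, (m : EReal) ≤ a →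
      ((r * m : ℝ) : EReal) ≤ algConn (bipartiteBetween G {u | c u = i} {u | c u = j}))
    (hr : 0 ≤ r)
    (hframe : ∀ m : ℝ, 0 ≤ m → ∀ x : Fin d → ℝ, ∑ k, x k = 0 → ∀ i,
      m * ∑ k, x k ^ 2 ≤ r * m * ((∑ j, (x i - x j) ^ 2) / 2)) :
    a ≤ algConnDim d G := by
  refine le_of_forall_lt_imp_le_of_dense fun b hb => ?_
  obtain ⟨m', hbm', hm'⟩ := EReal.lt_iff_exists_real_btwn.1 hb
  obtain ⟨m, hm'm, hm⟩ := EReal.lt_iff_exists_real_btwn.1 hm'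
  refine hbm'.le.trans ?_
  -- Laplacian forms are nonnegative, so truncating at `0` keeps the gaps; `hframe` asks for a
  -- nonnegative constant.
  refine le_algConnDim G hd hc (m := max m 0) (m₂ := r * max m 0) ?_ ?_
    (hframe _ (le_max_right _ _)) (lt_max_of_lt_left (EReal.coe_lt_coe_iff.1 hm'm))
  · intro i _
    obtain ⟨u, hu⟩ := hc i
    have : Nonempty {u | c u = i} := ⟨⟨u, hu⟩⟩
    exact (hasGap_of_le_algConn (hm.le.trans (h₁ i))).max_zero
  · intro i j hij _
    obtain ⟨u, hu⟩ := hc i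
    have : Nonempty ({u | c u = i} ∪ {u | c u = j} : Set V) := ⟨⟨u, Or.inl hu⟩⟩
    rw [mul_max_of_nonneg _ _ hr, mul_zero]
    exact (hasGap_of_le_algConn (h₂ i j hij m hm.le)).max_zero

end Rigidity

theorem theorem1p2 {V : Type*} [Finite V] (G : SimpleGraph V) (d : ℕ) (hd : 2 ≤ d)
    (A : Fin d → Set V) (hne : ∀ i, (A i).Nonempty)
    (hdisj : Pairwise fun i j => Disjoint (A i) (A j)) (hcover : ⋃ i, A i = Set.univ) :
    ((⨅ i, Rigidity.algConn (G.induce (A i))) ⊓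
        (⨅ i, ⨅ j, ⨅ _ : i < j,
          ((1 / 2 : ℝ) : EReal) * Rigidity.algConn (Rigidity.bipartiteBetween G (A i) (A j)))
      ≤ Rigidity.algConnDim d G) ∧
    ((∀ i, (G.induce (A i)).Connected) →
      (∀ i j, i < j → (Rigidity.bipartiteBetween G (A i) (A j)).Connected) →
      Rigidity.IsRigid d G) ∧
    (d = 2 →
      (⨅ i, Rigidity.algConn (G.induce (A i))) ⊓
          (⨅ i, ⨅ j, ⨅ _ : i < j,
            Rigidity.algConn (Rigidity.bipartiteBetween G (A i) (A j)))
        ≤ Rigidity.algConnDim d G) := by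
  have := Fintype.ofFinite V
  have hex : ∀ v, ∃ i, v ∈ A i := fun v => Set.mem_iUnion.1 (hcover ▸ Set.mem_univ v)
  choose c hc using hex
  have huniq : ∀ v i, v ∈ A i → c v = i := fun v i hv => by
    by_contra h
    exact Set.disjoint_left.1 (hdisj h) (hc v) hv
  obtain rfl : A = fun i => {u | c u = i} :=
    funext fun i => Set.ext fun v => ⟨huniq v i, fun h => h ▸ hc v⟩
  have hsurj : Function.Surjective c := fun i => hne i
  have hd0 : d ≠ 0 := by omega
  refine ⟨?_, Rigidity.isRigid_of_connected G hd0 hsurj, ?_⟩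
  · refine Rigidity.min_le_algConnDim G hd0 hsurj (r := 2) (fun i => inf_le_left.trans (iInf_le _ i))
      (fun i j hij m hm => Rigidity.two_mul_le_of_le_half_mul ?_) two_pos.le
      fun m hm x hx i => Rigidity.frame_bound hm hx i
    exact (hm.trans inf_le_right).trans ((iInf_le _ i).trans ((iInf_le _ j).trans (iInf_le _ hij)))
  · rintro rfl
    refine Rigidity.min_le_algConnDim G hd0 hsurj (r := 1) (fun i => inf_le_left.trans (iInf_le _ i))
      (fun i j hij m hm => ?_) one_pos.le
      fun m hm x hx i => by
        rw [one_mul]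
        exact Rigidity.frame_bound_two hx i
    rw [one_mul]
    exact (hm.trans inf_le_right).trans ((iInf_le _ i).trans ((iInf_le _ j).trans (iInf_le _ hij)))
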